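/- Let $\tau$ be a finite relational signature. An SNP $\tau$-sentence is a sentence $\Phi=\exists X_1,\dots,X_\ell\,\forall \bar x.\,\phi(\bar x)$, where $\sigma=\{X_1,\dots,X_\ell\}$ is a finite set of relation symbols disjoint from $\tau$ and $\phi$ is a quantifier-free $(\tau\cup\sigma)$-formula in conjunctive normal form, whose atoms may include equalities. Let $\mathrm{fm}(\Phi)$ be the class of all finite $\tau$-structures satisfying $\Phi$, let $\mathrm{efm}(\Phi)$ be the class of all finite $(\tau\cup\sigma)$-structures satisfying the first-order part $\forall\bar x.\,\phi(\bar x)$, and let $\mathrm{ar}(\Phi)$ be the maximum arity of the symbols in $\tau\cup\sigma$. For structures $\mathbf A,\mathbf W$ of the same signature, let $\binom{\mathbf W}{\mathbf A}$ be the set of all embeddings of $\mathbf A$ into $\mathbf W$. A class $\mathcal K$ of finite structures that is closed under isomorphisms and substructures has the amalgamation property (AP) if any two structures $\mathbf A,\mathbf B\in\mathcal K$ that induce the same substructure on $A\cap B$ (which may be empty) have embeddings $e\colon\mathbf A\hookrightarrow\mathbf W$ and $f\colon\mathbf B\hookrightarrow\mathbf W$ into some $\mathbf W\in\mathcal K$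 with $e|_{A\cap B}=f|_{A\cap B}$. It has the Ramsey property (RP) if for all $\mathbf A,\mathbf B\in\mathcal K$ and $k\in\mathbb N$ there is $\mathbf W\in\mathcal K$ such that for every map $f\colon\binom{\mathbf W}{\mathbf A}\to\{1,\dots,k\}$ there is $e\in\binom{\mathbf W}{\mathbf B}$ such that $f$ is constant on $\{e\circ u : u\in\binom{\mathbf B}{\mathbf A}\}$. The $n$-colours of $\Phi$ are the structures in $\mathrm{efm}(\Phi)$ whose domain is $\{1,\dots,m\}$ for some $m\le n$. For SNP $\tau$-sentences $\Phi_1,\Phi_2$ and $n=\max(\mathrm{ar}(\Phi_1),\mathrm{ar}(\Phi_2))$, a recolouring from $\Phi_1$ to $\Phi_2$ is a map $\xi$ from the $n$-colours of $\Phi_1$ to the $n$-colours of $\Phi_2$ such that (a) for every $n$-colour $\mathbf T$ of $\Phi_1$, the $\tau$-reducts of $\mathbf T$ and $\xi(\mathbf T)$ are identical; (b) for every $\mathbf A\in\mathrm{efm}(\Phi_1)$ there is a structure $\mathbf A'\in\mathrm{efm}(\Phi_2)$ on the same domain such that, for every $n$-colour $\mathbf T$ of $\Phi_1$, every embedding of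 $\mathbf T$ into $\mathbf A$ is also an embedding of $\xi(\mathbf T)$ into $\mathbf A'$. **Proposition.** Let $\Phi_1$ and $\Phi_2$ be SNP $\tau$-sentences such that $\mathrm{efm}(\Phi_1)$ and $\mathrm{efm}(\Phi_2)$ both have the AP and the RP. Then $\mathrm{fm}(\Phi_1)\subseteq\mathrm{fm}(\Phi_2)$ if and only if there exists a recolouring from $\Phi_1$ to $\Phi_2$. -/

import Mathlib

universe u v

namespace SNPContainment

open FirstOrder FirstOrder.Language CategoryTheory

/-- The literals over `L`: relational atoms, equalities, and their negations. -/
inductive IsLiteral {L : FirstOrder.Language.{u, v}} {n : ℕ} : L.BoundedFormula Empty n → Prop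
  | pos {φ : L.BoundedFormula Empty n} (h : φ.IsAtomic) : IsLiteral φ
  | neg {φ : L.BoundedFormula Empty n} (h : φ.IsAtomic) : IsLiteral φ.not

/-- The clauses over `L`: finite (possibly empty) disjunctions of literals. -/
inductive IsClause {L : FirstOrder.Language.{u, v}} {n : ℕ} : L.BoundedFormula Empty n → Prop
  | bot : IsClause ⊥
  | literal {φ : L.BoundedFormula Empty n} (h : IsLiteral φ) : IsClause φ
  | sup {φ ψ : L.BoundedFormula Empty n} (hφ : IsClause φ) (hψ : IsClause ψ) : IsClause (φ ⊔ ψ)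

/-- The formulas in conjunctive normal form: finite (possibly empty) conjunctions of clauses. -/
inductive IsCNF {L : FirstOrder.Language.{u, v}} {n : ℕ} : L.BoundedFormula Empty n → Prop
  | top : IsCNF ⊤
  | clause {φ : L.BoundedFormula Empty n} (h : IsClause φ) : IsCNF φ
  | inf {φ ψ : L.BoundedFormula Empty n} (hφ : IsCNF φ) (hψ : IsCNF ψ) : IsCNF (φ ⊓ ψ)

/-- An SNP `τ`-sentence `∃ X₁, …, Xₗ ∀ x₁, …, xₖ. φ`, where `σ = {X₁, …, Xₗ}` is a finite relational
signature and `φ` is a quantifier-free `(τ ∪ σ)`-formula in conjunctive normal form.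
The union `τ ∪ σ` of the disjoint signatures is `τ.sum σ`. -/
structure SNPSentence (τ : FirstOrder.Language.{u, v}) where
  /-- the existential symbols -/
  σ : FirstOrder.Language.{u, v}
  relational : σ.IsRelational
  finite : Finite σ.Symbols
  /-- the number of universally quantified first-order variables -/
  numVars : ℕ
  /-- the quantifier-free part -/
  matrix : (τ.sum σ).BoundedFormula Empty numVars
  isCNF : IsCNF matrix

/-- The maximum arity among the relation symbols of a finite signature (`0` if there are none). -/
noncomputable def maxArity (L : FirstOrder.Language.{u, v}) : ℕ :=
  sSup {k | Nonempty (L.Relations k)}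

/-- The `τ`-reduct of a `(τ ∪ σ)`-structure with domain `A`. -/
abbrev inputReduct {τ σ : FirstOrder.Language.{u, v}} {A : Type} (S : (τ.sum σ).Structure A) :
    τ.Structure A :=
  letI := S
  (LHom.sumInl : τ →ᴸ τ.sum σ).reduct A

/-- The map `e` is an embedding of the structure `S` on `A` into the structure `S'` on `B`. -/
def IsEmbedding {L : FirstOrder.Language.{u, v}} {A B : Type} (S : L.Structure A)
    (S' : L.Structure B) (e : A → B) : Prop :=
  ∃ e' : A ↪[L] B, ⇑e' = e

namespace SNPSentence

variable {τ : FirstOrder.Language.{u, v}}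

/-- The arity of `Φ`: the maximum arity among the symbols in `τ ∪ σ`. -/
noncomputable def ar (Φ : SNPSentence τ) : ℕ := maxArity (τ.sum Φ.σ)

/-- The first-order part `∀ x₁, …, xₖ. φ` of `Φ`. -/
def firstOrderPart (Φ : SNPSentence τ) : (τ.sum Φ.σ).Sentence := Φ.matrix.alls

/-- The class of all finite models of the first-order part of `Φ`. -/
def efm (Φ : SNPSentence τ) : Set (Bundled.{0} (τ.sum Φ.σ).Structure) :=
  {A | Finite A ∧ A ⊨ Φ.firstOrderPart}

/-- The class of all finite models of `Φ`: the finite `τ`-structures which have a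
`(τ ∪ σ)`-expansion satisfying the first-order part of `Φ`. -/
def fm (Φ : SNPSentence τ) : Set (Bundled.{0} τ.Structure) :=
  {A | Finite A ∧ ∃ S : (τ.sum Φ.σ).Structure A,
    inputReduct S = A.str ∧ @Sentence.Realize (τ.sum Φ.σ) A S Φ.firstOrderPart}

/-- The standard structures of size exactly `m` in `efm Φ`; their domain is `Fin m`.
The `n`-colours of `Φ` are the elements of `Φ.Colour m` for `m ≤ n`. -/
def Colour (Φ : SNPSentence τ) (m : ℕ) : Type (max u v) :=
  {T : (τ.sum Φ.σ).Structure (Fin m) // (⟨Fin m, T⟩ : Bundled.{0} (τ.sum Φ.σ).Structure) ∈ Φ.efm}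

end SNPSentence

/-- `Recolouring Φ₁ Φ₂` is the type of recolourings from `Φ₁` to `Φ₂`. -/
structure Recolouring {τ : FirstOrder.Language.{u, v}} (Φ₁ Φ₂ : SNPSentence τ) where
  /-- The map from the `n`-colours of `Φ₁` to those of `Φ₂`, where `n = max (ar Φ₁) (ar Φ₂)`.
  Since it has to preserve `τ`-reducts, and so domains, it maps colours with domain `Fin m` to
  colours with domain `Fin m`. -/
  ξ : ∀ m : ℕ, m ≤ max Φ₁.ar Φ₂.ar → Φ₁.Colour m → Φ₂.Colour m
  /-- The `τ`-reducts of an `n`-colour and of its image are identical. -/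
  reduct_eq : ∀ (m : ℕ) (hm : m ≤ max Φ₁.ar Φ₂.ar) (T : Φ₁.Colour m),
    inputReduct (ξ m hm T).1 = inputReduct T.1
  /-- For every `A ∈ efm Φ₁` there is `A' ∈ efm Φ₂` on the same domain such that every embedding
  of an `n`-colour `T` of `Φ₁` into `A` is also an embedding of `ξ T` into `A'`. -/
  compatible : ∀ A ∈ Φ₁.efm, ∃ S : (τ.sum Φ₂.σ).Structure A,
    (⟨A, S⟩ : Bundled.{0} (τ.sum Φ₂.σ).Structure) ∈ Φ₂.efm ∧
    ∀ (m : ℕ) (hm : m ≤ max Φ₁.ar Φ₂.ar) (T : Φ₁.Colour m) (e : Fin m → A),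
      IsEmbedding T.1 A.str e → IsEmbedding (ξ m hm T).1 S e

/-- The Ramsey property of a class `K` of `L`-structures, for colourings of embeddings. -/
def RamseyProperty {L : FirstOrder.Language.{u, v}} (K : Set (Bundled.{0} L.Structure)) : Prop :=
  ∀ A ∈ K, ∀ B ∈ K, ∀ k : ℕ, ∃ W ∈ K, ∀ f : (A ↪[L] W) → Fin k,
    ∃ e : B ↪[L] W, ∀ u₁ u₂ : A ↪[L] B, f (e.comp u₁) = f (e.comp u₂)

end SNPContainment

/-! A recolouring fixes the `τ`-reducts of all small substructures, and a `τ`-tuple has at most `ar`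
distinct entries, so the whole reduct is kept and containment follows. Conversely, let `A` be in
`efm Φ₁`, and let `W` be a Ramsey structure for `A` and all `n`-colours. By containment the reduct
of `W` expands to a structure in `efm Φ₂`, which assigns to each copy of an `n`-colour `T` in `W` a
colour of `Φ₂`. On some copy of `A` this depends on `T` alone, so some colour map fits `A`
(`exists_fits`). There are finitely many colour maps, fitting passes to substructures, and
structures with equal nullary relations embed jointly. Hence one map serves all of them
(`exists_fits_of_emptyPart`). Since each colour records the nullary relations, these maps glue to a
recolouring. -/

namespace SNPContainment

open FirstOrder FirstOrder.Language CategoryTheory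

/-! ### Induced relational structures -/

section Pullback

variable {L : FirstOrder.Language.{u, v}} [L.IsRelational] {A B C : Type}

/-- The structure induced on `B` by a relational structure on `A` along a map `B → A`. -/
abbrev pullback (S : L.Structure A) (e : B → A) : L.Structure B where
  funMap f := isEmptyElim f
  RelMap r x := S.RelMap r (e ∘ x)

theorem structure_ext {S S' : L.Structure A}
    (h : ∀ (k : ℕ) (r : L.Relations k) (x : Fin k → A), S.RelMap r x ↔ S'.RelMap r x) :
    S = S' := by
  apply FirstOrder.Language.Structure.ext
  · funext k f
    exact isEmptyElim f
  · funext k r x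
    exact propext (h k r x)

theorem pullback_pullback (S : L.Structure A) (e : B → A) (f : C → B) :
    pullback (pullback S e) f = pullback S (e ∘ f) := rfl

/-- An injective map is an embedding of the pulled back structure. -/
def pullbackEmbedding (S : L.Structure A) (e : B → A) (he : Function.Injective e) :
    @FirstOrder.Language.Embedding L B A (pullback S e) S :=
  letI := pullback S e
  letI := S
  { toFun := e
    inj' := he
    map_fun' := fun f => isEmptyElim f
    map_rel' := fun _ _ => Iff.rfl }

theorem eq_pullback_of_embedding (S : L.Structure A) (S' : L.Structure B)
    (e : @FirstOrder.Language.Embedding L B A S' S) : S' = pullback S e.toFun :=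
  structure_ext fun _ r x => (e.map_rel' r x).symm

theorem isEmbedding_iff (S : L.Structure A) (S' : L.Structure B) (e : B → A) :
    IsEmbedding S' S e ↔ Function.Injective e ∧ S' = pullback S e := by
  constructor
  · rintro ⟨e', rfl⟩
    exact ⟨e'.toEmbedding.injective, eq_pullback_of_embedding S S' e'⟩
  · rintro ⟨he, rfl⟩
    exact ⟨pullbackEmbedding S e he, rfl⟩

theorem finite_structure [Finite L.Symbols] [Finite A] : Finite (L.Structure A) := by
  have : Finite (Σ l, L.Relations l) :=
    Finite.of_injective (fun r => (Sum.inr r : L.Symbols)) Sum.inr_injective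
  refine Finite.of_injective
    (fun (S : L.Structure A) (r : Σ l, L.Relations l) (x : Fin r.1 → A) => S.RelMap r.2 x) ?_
  intro S S' h
  exact structure_ext fun k r x => iff_of_eq (congrFun (congrFun h ⟨k, r⟩) x)

end Pullback

theorem le_maxArity {L : FirstOrder.Language.{u, v}} [Finite L.Symbols] {k : ℕ}
    (r : L.Relations k) : k ≤ maxArity L := by
  have : Finite (Σ l, L.Relations l) :=
    Finite.of_injective (fun r => (Sum.inr r : L.Symbols)) Sum.inr_injective
  refine le_csSup (Set.Finite.bddAbove ?_) ⟨r⟩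
  refine (Set.finite_range (fun r : Σ l, L.Relations l => r.1)).subset ?_
  rintro l ⟨r⟩
  exact ⟨⟨l, r⟩, rfl⟩

theorem finite_symbols_sum (L L' : FirstOrder.Language.{u, v}) [Finite L.Symbols]
    [Finite L'.Symbols] : Finite (L.sum L').Symbols := by
  refine Finite.of_injective (β := L.Symbols ⊕ L'.Symbols)
    (fun s => match s with
      | .inl ⟨k, .inl f⟩ => .inl (.inl ⟨k, f⟩)
      | .inl ⟨k, .inr f⟩ => .inr (.inl ⟨k, f⟩)
      | .inr ⟨k, .inl r⟩ => .inl (.inr ⟨k, r⟩)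
      | .inr ⟨k, .inr r⟩ => .inr (.inr ⟨k, r⟩)) ?_
  rintro (⟨k, f | f⟩ | ⟨k, f | f⟩) (⟨l, g | g⟩ | ⟨l, g | g⟩) h <;> simp at h <;>
    obtain ⟨rfl, h⟩ := h <;> simp_all

theorem inputReduct_pullback {τ σ : FirstOrder.Language.{u, v}} [τ.IsRelational]
    [σ.IsRelational] {A B : Type} (S : (τ.sum σ).Structure A) (e : B → A) :
    inputReduct (pullback S e) = pullback (inputReduct S) e :=
  structure_ext fun _ _ _ => Iff.rfl

section Formula

variable {L : FirstOrder.Language.{u, v}} {n : ℕ} {φ : L.BoundedFormula Empty n}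

theorem IsLiteral.isQF (h : IsLiteral φ) : φ.IsQF := by
  cases h with
  | pos h => exact h.isQF
  | neg h => exact h.isQF.not

theorem IsClause.isQF (h : IsClause φ) : φ.IsQF := by
  induction h with
  | bot => exact BoundedFormula.isQF_bot
  | literal h => exact h.isQF
  | sup _ _ h₁ h₂ => exact h₁.not.imp h₂

theorem IsCNF.isQF (h : IsCNF φ) : φ.IsQF := by
  induction h with
  | top => exact BoundedFormula.IsQF.top
  | clause h => exact h.isQF
  | inf _ _ h₁ h₂ => exact (h₁.imp h₂.not).not

theorem isUniversal_alls (h : φ.IsUniversal) : φ.alls.IsUniversal := by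
  induction n with
  | zero => exact h
  | succ n ih => exact ih h.all

end Formula

namespace SNPSentence

variable {τ : FirstOrder.Language.{u, v}}

instance (Φ : SNPSentence τ) : Φ.σ.IsRelational := Φ.relational

instance (Φ : SNPSentence τ) : Finite Φ.σ.Symbols := Φ.finite

theorem isUniversal_firstOrderPart (Φ : SNPSentence τ) : Φ.firstOrderPart.IsUniversal :=
  isUniversal_alls Φ.isCNF.isQF.isUniversal

/-- Universal sentences pass to substructures. -/
theorem pullback_mem_efm [τ.IsRelational] {Φ : SNPSentence τ} {A B : Type} {S : (τ.sum Φ.σ).Structure A}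
    (h : (⟨A, S⟩ : Bundled.{0} (τ.sum Φ.σ).Structure) ∈ Φ.efm) {e : B → A}
    (he : Function.Injective e) :
    (⟨B, pullback S e⟩ : Bundled.{0} (τ.sum Φ.σ).Structure) ∈ Φ.efm := by
  obtain ⟨hfin, hA⟩ := h
  have : Finite A := hfin
  refine ⟨Finite.of_injective e he, ?_⟩
  let := S
  let := pullback S e
  refine Φ.isUniversal_firstOrderPart.realize_embedding (pullbackEmbedding S e he) ?_
  rw [Unique.eq_default (_ ∘ _), Unique.eq_default (_ ∘ _)]
  exact hA

instance [τ.IsRelational] [Finite τ.Symbols] (Φ : SNPSentence τ) (m : ℕ) : Finite (Φ.Colour m) := by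
  have := finite_symbols_sum τ Φ.σ
  have : Finite ((τ.sum Φ.σ).Structure (Fin m)) := finite_structure
  exact Subtype.finite

theorem le_ar [Finite τ.Symbols] (Φ : SNPSentence τ) {k : ℕ} (r : τ.Relations k) : k ≤ Φ.ar :=
  have := finite_symbols_sum τ Φ.σ
  le_maxArity (L := τ.sum Φ.σ) (Sum.inl r)

/-- The class of finite models of `Φ` consists of the `τ`-reducts of structures in `efm Φ`. -/
theorem exists_of_mem_fm {Φ : SNPSentence τ} {A : Type} {S₀ : τ.Structure A}
    (h : (⟨A, S₀⟩ : Bundled.{0} τ.Structure) ∈ Φ.fm) :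
    ∃ S : (τ.sum Φ.σ).Structure A, (⟨A, S⟩ : Bundled.{0} (τ.sum Φ.σ).Structure) ∈ Φ.efm ∧
      inputReduct S = S₀ := by
  obtain ⟨hfin, S, h₁, h₂⟩ := h
  exact ⟨S, ⟨hfin, h₂⟩, h₁⟩

theorem reduct_mem_fm {Φ : SNPSentence τ} {A : Type} {S : (τ.sum Φ.σ).Structure A}
    (h : (⟨A, S⟩ : Bundled.{0} (τ.sum Φ.σ).Structure) ∈ Φ.efm) :
    (⟨A, inputReduct S⟩ : Bundled.{0} τ.Structure) ∈ Φ.fm :=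
  ⟨h.1, S, rfl, h.2⟩

end SNPSentence

/-! ### Containment and recolourings -/

section Containment

variable {τ : FirstOrder.Language.{u, v}} [τ.IsRelational]
  {Φ₁ Φ₂ : SNPSentence τ}

theorem Recolouring.fm_subset [Finite τ.Symbols] (R : Recolouring Φ₁ Φ₂) : Φ₁.fm ⊆ Φ₂.fm := by
  rintro ⟨A, S₀⟩ hA
  obtain ⟨S, hS, rfl⟩ := SNPSentence.exists_of_mem_fm hA
  obtain ⟨S', hS', hcomp⟩ := R.compatible _ hS
  suffices h : inputReduct S' = inputReduct S from h ▸ SNPSentence.reduct_mem_fm hS'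
  refine structure_ext fun k r x => ?_
  classical
  have : Finite (Set.range x) := Set.finite_range x
  obtain ⟨m, ⟨g⟩⟩ := Finite.exists_equiv_fin (Set.range x)
  -- The colour lives on the set of entries of `x`, so repeated entries only make it smaller.
  have hm : m ≤ k := by
    have h := Finite.card_range_le x
    rwa [Nat.card_congr g, Nat.card_fin, Nat.card_fin] at h
  have hm' : m ≤ max Φ₁.ar Φ₂.ar := (hm.trans (Φ₁.le_ar r)).trans (le_max_left _ _)
  let e : Fin m → A := fun i => (g.symm i).1
  have he : Function.Injective e := Subtype.val_injective.comp g.symm.injective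
  let y : Fin k → Fin m := fun i => g ⟨x i, i, rfl⟩
  have hy : e ∘ y = x := by
    funext i
    simp [e, y]
  let T : Φ₁.Colour m := ⟨pullback S e, SNPSentence.pullback_mem_efm hS he⟩
  have hT := ((isEmbedding_iff _ _ _).1
    (hcomp m hm' T e ((isEmbedding_iff _ _ _).2 ⟨he, rfl⟩))).2
  have hred := R.reduct_eq m hm' T
  rw [hT, inputReduct_pullback, inputReduct_pullback] at hred
  have h : (inputReduct S').RelMap r (e ∘ y) = (inputReduct S).RelMap r (e ∘ y) :=
    congrArg (fun U : τ.Structure (Fin m) => U.RelMap r y) hred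
  rw [hy] at h
  exact iff_of_eq h

/-- The Ramsey property for finitely many coloured structures, and colourings in finite types. -/
theorem RamseyProperty.finite_family {L : FirstOrder.Language.{u, v}}
    {K : Set (Bundled.{0} L.Structure)} (hK : RamseyProperty K) {I : Type*} [Finite I]
    (T : I → Bundled.{0} L.Structure) (hT : ∀ i, T i ∈ K) (C : I → Type*) [∀ i, Finite (C i)]
    {B : Bundled.{0} L.Structure} (hB : B ∈ K) :
    ∃ W ∈ K, ∀ f : ∀ i, (T i ↪[L] W) → C i,
      ∃ e : B ↪[L] W, ∀ i, ∀ u₁ u₂ : T i ↪[L] B, f i (e.comp u₁) = f i (e.comp u₂) := by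
  classical
  have := Fintype.ofFinite I
  suffices h : ∀ s : Finset I, ∃ W ∈ K, ∀ f : ∀ i, (T i ↪[L] W) → C i,
      ∃ e : B ↪[L] W, ∀ i ∈ s, ∀ u₁ u₂ : T i ↪[L] B,
        f i (e.comp u₁) = f i (e.comp u₂) by
    simpa using h Finset.univ
  intro s
  induction s using Finset.induction_on with
  | empty => exact ⟨B, hB, fun _ => ⟨Embedding.refl L B, by simp⟩⟩
  | insert i s _ ih =>
    obtain ⟨W₁, hW₁, h₁⟩ := ih
    obtain ⟨k, ⟨g⟩⟩ := Finite.exists_equiv_fin (C i)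
    obtain ⟨W₂, hW₂, h₂⟩ := hK (T i) (hT i) W₁ hW₁ k
    refine ⟨W₂, hW₂, fun f => ?_⟩
    -- First fix a copy of `W₁` on which colouring `i` is constant; the other colourings are then
    -- restricted to this copy.
    obtain ⟨e₂, he₂⟩ := h₂ fun u => g (f i u)
    obtain ⟨e₁, he₁⟩ := h₁ fun j u => f j (e₂.comp u)
    refine ⟨e₂.comp e₁, fun j hj u₁ u₂ => ?_⟩
    rw [Embedding.comp_assoc, Embedding.comp_assoc]
    rcases Finset.mem_insert.1 hj with rfl | hj
    · exact g.injective (he₂ (e₁.comp u₁) (e₁.comp u₂))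
    · exact he₁ j hj u₁ u₂

/-- The maps between small colours which preserve the input symbols. -/
abbrev ColourMap (Φ₁ Φ₂ : SNPSentence τ) (n : ℕ) : Type (max u v) :=
  ∀ m : Fin (n + 1), ∀ T : Φ₁.Colour m, {T' : Φ₂.Colour m // inputReduct T'.1 = inputReduct T.1}

/-- A colour map fits a structure `A` if the expansion that it prescribes on the small substructures
of `A` extends to a structure in `efm Φ₂`. -/
def ColourMap.Fits {n : ℕ} (ξ : ColourMap Φ₁ Φ₂ n) (A : Bundled.{0} (τ.sum Φ₁.σ).Structure) :
    Prop :=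
  ∃ S : (τ.sum Φ₂.σ).Structure A, (⟨A, S⟩ : Bundled.{0} (τ.sum Φ₂.σ).Structure) ∈ Φ₂.efm ∧
    ∀ (m : Fin (n + 1)) (T : Φ₁.Colour m) (e : Fin m → A),
      IsEmbedding T.1 A.str e → IsEmbedding (ξ m T).1.1 S e

theorem ColourMap.Fits.of_embedding {n : ℕ} {ξ : ColourMap Φ₁ Φ₂ n}
    {A B : Bundled.{0} (τ.sum Φ₁.σ).Structure} (h : ξ.Fits B) (f : A ↪[τ.sum Φ₁.σ] B) :
    ξ.Fits A := by
  obtain ⟨S, hS, hcomp⟩ := h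
  refine ⟨pullback S f, SNPSentence.pullback_mem_efm hS f.injective, fun m T e he => ?_⟩
  rw [isEmbedding_iff] at he ⊢
  obtain ⟨he, hT⟩ := he
  refine ⟨he, ((isEmbedding_iff _ _ _).1 (hcomp m T (f ∘ e) ?_)).2⟩
  rw [isEmbedding_iff]
  refine ⟨f.injective.comp he, hT.trans ?_⟩
  rw [eq_pullback_of_embedding B.str A.str f]
  rfl

/-- The colouring fed to the Ramsey property sends a copy of `T` to the structure that a
`Φ₂`-expansion of `W` induces on it. -/
theorem exists_fits [Finite τ.Symbols] (hRP : RamseyProperty Φ₁.efm) (hsub : Φ₁.fm ⊆ Φ₂.fm) (n : ℕ)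
    {A : Bundled.{0} (τ.sum Φ₁.σ).Structure} (hA : A ∈ Φ₁.efm) :
    ∃ ξ : ColourMap Φ₁ Φ₂ n, ξ.Fits A := by
  classical
  obtain ⟨W, hW, hramsey⟩ := hRP.finite_family
    (I := Σ m : Fin (n + 1), Φ₁.Colour m) (fun i => ⟨Fin i.1, i.2.1⟩) (fun i => i.2.2)
    (fun i => Φ₂.Colour i.1) hA
  obtain ⟨S, hS, hred⟩ := SNPSentence.exists_of_mem_fm
    (hsub (SNPSentence.reduct_mem_fm (A := W) (S := W.str) hW))
  obtain ⟨e, he⟩ := hramsey fun i u =>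
    letI : (τ.sum Φ₁.σ).Structure (Fin i.1) := i.2.1
    letI u' : Fin i.1 ↪[τ.sum Φ₁.σ] W := u
    ⟨pullback S u'.toFun, SNPSentence.pullback_mem_efm hS u'.toEmbedding.injective⟩
  have key : ∀ (m : Fin (n + 1)) (T : Φ₁.Colour m),
      ∃ T' : {T' : Φ₂.Colour m // inputReduct T'.1 = inputReduct T.1},
        ∀ u : Fin m → A, IsEmbedding T.1 A.str u → T'.1.1 = pullback S (e ∘ u) := by
    intro m T
    by_cases hu : ∃ u : Fin m → A, IsEmbedding T.1 A.str u
    · obtain ⟨_, u, rfl⟩ := hu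
      let := T.1
      have heu : Function.Injective (e ∘ u) := e.injective.comp u.toEmbedding.injective
      refine ⟨⟨⟨pullback S (e ∘ u), SNPSentence.pullback_mem_efm hS heu⟩, ?_⟩, ?_⟩
      · have hT : T.1 = pullback W.str (e ∘ u) := eq_pullback_of_embedding W.str T.1 (e.comp u)
        rw [inputReduct_pullback, hred, ← inputReduct_pullback]
        exact congrArg inputReduct hT.symm
      · rintro _ ⟨u', rfl⟩
        exact congrArg Subtype.val (he ⟨m, T⟩ u u')
    -- `T` does not embed into `A`, so any `Φ₂`-expansion of its reduct will do.
    · obtain ⟨S', hS', hred'⟩ := SNPSentence.exists_of_mem_fm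
        (hsub (SNPSentence.reduct_mem_fm T.2))
      exact ⟨⟨⟨S', hS'⟩, hred'⟩, fun u h => (hu ⟨u, h⟩).elim⟩
  choose ξ hξ using key
  refine ⟨ξ, pullback S e, SNPSentence.pullback_mem_efm hS e.injective, fun m T u hu => ?_⟩
  rw [isEmbedding_iff]
  exact ⟨((isEmbedding_iff _ _ _).1 hu).1, hξ m T u hu⟩

/-- The substructure on the empty set, which records the nullary relations. -/
abbrev emptyPart {L : FirstOrder.Language.{u, v}} [L.IsRelational] {A : Type} (S : L.Structure A) :
    L.Structure (Fin 0) :=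
  pullback S Fin.elim0

theorem emptyPart_pullback {L : FirstOrder.Language.{u, v}} [L.IsRelational] {A B : Type}
    (S : L.Structure A) (e : B → A) : emptyPart (pullback S e) = emptyPart S := by
  rw [emptyPart, pullback_pullback, Subsingleton.elim (e ∘ Fin.elim0) Fin.elim0, emptyPart]

/-- Structures with the same nullary relations have a joint embedding. -/
theorem exists_joint_embedding (hAP : Amalgamation Φ₁.efm)
    {A B : Bundled.{0} (τ.sum Φ₁.σ).Structure} (hA : A ∈ Φ₁.efm) (hB : B ∈ Φ₁.efm)
    (h : emptyPart A.str = emptyPart B.str) :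
    ∃ C ∈ Φ₁.efm, Nonempty (A ↪[τ.sum Φ₁.σ] C) ∧ Nonempty (B ↪[τ.sum Φ₁.σ] C) := by
  have h₀ : ∀ X : Type, Function.Injective (Fin.elim0 : Fin 0 → X) :=
    fun _ => Function.injective_of_subsingleton _
  let fA := pullbackEmbedding A.str Fin.elim0 (h₀ A)
  have fB := pullbackEmbedding B.str Fin.elim0 (h₀ B)
  rw [show pullback B.str Fin.elim0 = pullback A.str Fin.elim0 from h.symm] at fB
  obtain ⟨C, f, g, hC, -⟩ := hAP ⟨Fin 0, emptyPart A.str⟩ A B fA fB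
    (SNPSentence.pullback_mem_efm hA (h₀ A)) hA hB
  exact ⟨C, hC, ⟨f⟩, ⟨g⟩⟩

/-- A single colour map fits all structures with given nullary relations. -/
theorem exists_fits_of_emptyPart [Finite τ.Symbols] (hAP : Amalgamation Φ₁.efm) (hRP : RamseyProperty Φ₁.efm)
    (hsub : Φ₁.fm ⊆ Φ₂.fm) (n : ℕ) (E : (τ.sum Φ₁.σ).Structure (Fin 0)) :
    ∃ ξ : ColourMap Φ₁ Φ₂ n, ∀ A ∈ Φ₁.efm, emptyPart A.str = E → ξ.Fits A := by
  let P : Set (Set (ColourMap Φ₁ Φ₂ n)) :=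
    {s | ∃ A ∈ Φ₁.efm, emptyPart A.str = E ∧ s = {ξ | ξ.Fits A}}
  by_cases hP : P.Nonempty
  -- Choose `A` with a minimal set of fitting maps. Passing to a joint extension `C` of `A` and `B`
  -- can only shrink this set, so by minimality every map fitting `A` fits `C`, and hence `B`.
  · obtain ⟨s, hs⟩ := P.toFinite.exists_minimal hP
    obtain ⟨⟨A, hA, hAE, rfl⟩, hmin⟩ := hs
    obtain ⟨ξ, hξ⟩ := exists_fits hRP hsub n hA
    refine ⟨ξ, fun B hB hBE => ?_⟩
    obtain ⟨C, hC, ⟨f⟩, ⟨g⟩⟩ := exists_joint_embedding hAP hA hB (hAE.trans hBE.symm)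
    have hCE : emptyPart C.str = E := by
      rw [← hAE, eq_pullback_of_embedding C.str A.str f, emptyPart_pullback]
    have hle := hmin ⟨C, hC, hCE, rfl⟩ fun ζ hζ => ColourMap.Fits.of_embedding hζ f
    exact ColourMap.Fits.of_embedding (hle hξ) g
  · have key : ∀ (m : Fin (n + 1)) (T : Φ₁.Colour m),
        Nonempty {T' : Φ₂.Colour m // inputReduct T'.1 = inputReduct T.1} := by
      intro m T
      obtain ⟨S', hS', hred'⟩ := SNPSentence.exists_of_mem_fm
        (hsub (SNPSentence.reduct_mem_fm T.2))
      exact ⟨⟨⟨S', hS'⟩, hred'⟩⟩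
    exact ⟨fun m T => (key m T).some, fun A hA hAE => (hP ⟨_, A, hA, hAE, rfl⟩).elim⟩

theorem nonempty_recolouring [Finite τ.Symbols] (hAP : Amalgamation Φ₁.efm) (hRP : RamseyProperty Φ₁.efm)
    (hsub : Φ₁.fm ⊆ Φ₂.fm) : Nonempty (Recolouring Φ₁ Φ₂) := by
  choose ξ hξ using exists_fits_of_emptyPart hAP hRP hsub (max Φ₁.ar Φ₂.ar)
  refine ⟨⟨fun m hm T => (ξ (emptyPart T.1) ⟨m, Nat.lt_succ_of_le hm⟩ T).1,
    fun m hm T => (ξ (emptyPart T.1) ⟨m, Nat.lt_succ_of_le hm⟩ T).2, fun A hA => ?_⟩⟩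
  obtain ⟨S, hS, hcomp⟩ := hξ _ A hA rfl
  refine ⟨S, hS, fun m hm T e he => ?_⟩
  -- All colours embedding into `A` share its nullary relations, so they all use the map chosen for
  -- `A`.
  have hE : emptyPart T.1 = emptyPart A.str := by
    rw [((isEmbedding_iff _ _ _).1 he).2, emptyPart_pullback]
  rw [hE]
  exact hcomp ⟨m, Nat.lt_succ_of_le hm⟩ T e he

end Containment

end SNPContainment

/-- If the classes of finite models of the first-order parts of two SNP `τ`-sentences both have the
amalgamation property and the Ramsey property, then containment of their classes of finite models
is equivalent to the existence of a recolouring. -/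
theorem mainTheorem5 {τ : FirstOrder.Language.{u, v}} [τ.IsRelational] [Finite τ.Symbols]
    (Φ₁ Φ₂ : SNPContainment.SNPSentence τ)
    (hAP₁ : FirstOrder.Language.Amalgamation Φ₁.efm)
    (hRP₁ : SNPContainment.RamseyProperty Φ₁.efm)
    (hAP₂ : FirstOrder.Language.Amalgamation Φ₂.efm)
    (hRP₂ : SNPContainment.RamseyProperty Φ₂.efm) :
    Φ₁.fm ⊆ Φ₂.fm ↔ Nonempty (SNPContainment.Recolouring Φ₁ Φ₂) := by
  exact ⟨SNPContainment.nonempty_recolouring hAP₁ hRP₁, fun ⟨R⟩ => R.fm_subset⟩
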